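/- Let $\nu>0$. For $t\ge 1$ and a normalization constant $K>0$ put $$\alpha_t=\frac{4}{K^2}\,\frac{(2t+2\nu-1)(t+\nu-1)}{(t+2\nu-1)(2t+4\nu-1)},\qquad \beta_t=\frac{(t-1)(2t-3)(2t+2\nu-1)}{(t+2\nu-1)(2t+4\nu-1)(2t+2\nu-3)}\ \ (t\ge 2),\qquad \beta_1=0,$$ (so $\alpha_1=\frac1{K^2}\frac{4\nu+2}{4\nu+1}$). Given points $x_1,\dots,x_n$ of a real inner product space $\mathcal X$ and $y\in\mathbb R^n$, let $(\mathrm Xw)_i=\langle w,x_i\rangle$, $\mathrm X^*y=\frac1n\sum_i y_ix_i$, $\hat\Sigma=\mathrm X^*\mathrm X$. The $\nu$-method (heavy-ball with varying parameters) is $$\hat w_{t+1}=\hat w_t-\alpha_{t+1}\mathrm X^*(\mathrm X\hat w_t-y)+\beta_{t+1}(\hat w_t-\hat w_{t-1}),\qquad \hat w_{-1}=\hat w_0=0,$$ and its polynomials $g_t=g_t^{K}$ are defined by $g_{-1}=g_0=0$ and $g_{t+1}(\sigma)=g_t(\sigma)-\alpha_{t+1}(\sigma g_t(\sigma)-1)+\beta_{t+1}(g_t(\sigma)-g_{t-1}(\sigma))$.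 Let $r_t(\sigma)=1-\sigma g_t(\sigma)$. **Proposition.** For all $K>0$, all such data and all $t\ge 0$, $\hat w_t=g_t(\hat\Sigma)\mathrm X^*y$. Moreover there is a constant $0<c_\nu<\infty$, depending only on $\nu$, such that for every $0<\kappa\le 1$ the following holds, with $\lambda=1/t^2$, $t=1,2,\dots$ 1. For $K=1$ (no factor $1/\kappa^2$ in the step-sizes), the family $g_t$ is a spectral filtering function with constants $E=2$ and $F_0=1$, that is, for all $t\ge1$, $$\sup_{\sigma\in(0,\kappa^2]}|g_t(\sigma)|\le \frac{2}{\lambda}=2t^2,\qquad \sup_{\sigma\in(0,\kappa^2]}|r_t(\sigma)|\le 1 ;$$ and it has qualification $\nu$: for all $t\ge1$ $$\sup_{\sigma\in(0,\kappa^2]}|r_t(\sigma)\sigma^{\nu}|\le c_\nu\lambda^{\nu}=c_\nu t^{-2\nu},$$ and $\nu$ is the largest $q\ge0$ for which there is a constant $F_q$, independent of $t$, with $\sup_{\sigma\in(0,\kappa^2]}|r_t(\sigma)\sigma^{q}|\le F_q\lambda^{q}$ for all $t\ge 1$. 2. For $K=\kappa$ (step-sizes with the factor $1/\kappa^2$),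 the same holds with $E=2/\kappa^2$ in place of $E=2$. -/

import Mathlib

open Polynomial

/-! ### The least-squares problem and the heavy-ball iteration -/

section LeastSquares

variable {𝓧 : Type*} [NormedAddCommGroup 𝓧] [InnerProductSpace ℝ 𝓧]

/-- The sampling operator `(X w)_i = ⟪w, x_i⟫` of the inputs `x_1, …, x_n`. -/
noncomputable def samplingOp {n : ℕ} (x : Fin n → 𝓧) : 𝓧 →ₗ[ℝ] (Fin n → ℝ) :=
  LinearMap.pi fun i => innerₛₗ ℝ (x i)

/-- The adjoint `X* y = (1/n) ∑ᵢ yᵢ xᵢ` of the sampling operator, where `ℝⁿ` carries the Euclidean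
inner product multiplied by `1/n`. -/
noncomputable def samplingAdj {n : ℕ} (x : Fin n → 𝓧) : (Fin n → ℝ) →ₗ[ℝ] 𝓧 :=
  (1 / (n : ℝ)) • ∑ i, (LinearMap.proj i : (Fin n → ℝ) →ₗ[ℝ] ℝ).smulRight (x i)

theorem samplingOp_apply {n : ℕ} (x : Fin n → 𝓧) (w : 𝓧) (i : Fin n) :
    samplingOp x w i = inner ℝ w (x i) := by
  simp [samplingOp, real_inner_comm]

theorem samplingAdj_apply {n : ℕ} (x : Fin n → 𝓧) (y : Fin n → ℝ) :
    samplingAdj x y = (1 / (n : ℝ)) • ∑ i, y i • x i := by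
  simp [samplingAdj]

/-- The empirical covariance operator `Σ̂ = X* X`. -/
noncomputable def empiricalCov {n : ℕ} (x : Fin n → 𝓧) : Module.End ℝ 𝓧 :=
  samplingAdj x ∘ₗ samplingOp x

/-- Heavy-ball with varying parameters `α_t`, `β_t` for the least-squares problem:
`w_{t+1} = w_t - α_{t+1} X*(X w_t - y) + β_{t+1} (w_t - w_{t-1})`, with `w_{-1} = w_0 = 0`. -/
noncomputable def heavyBall (α β : ℕ → ℝ) {n : ℕ} (x : Fin n → 𝓧) (y : Fin n → ℝ) : ℕ → 𝓧
  | 0 => 0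
  | 1 => 0 - α 1 • samplingAdj x (samplingOp x 0 - y) + β 1 • (0 - 0)
  | t + 2 =>
      heavyBall α β x y (t + 1)
        - α (t + 2) • samplingAdj x (samplingOp x (heavyBall α β x y (t + 1)) - y)
        + β (t + 2) • (heavyBall α β x y (t + 1) - heavyBall α β x y t)

end LeastSquares

/-- The polynomials `g_t` of heavy-ball with varying parameters:
`g_{t+1}(σ) = g_t(σ) - α_{t+1} (σ g_t(σ) - 1) + β_{t+1} (g_t(σ) - g_{t-1}(σ))`,
with `g_{-1} = g_0 = 0`. -/
noncomputable def heavyBallPoly (α β : ℕ → ℝ) : ℕ → ℝ[X]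
  | 0 => 0
  | 1 => 0 - C (α 1) * (X * 0 - 1) + C (β 1) * (0 - 0)
  | t + 2 =>
      heavyBallPoly α β (t + 1)
        - C (α (t + 2)) * (X * heavyBallPoly α β (t + 1) - 1)
        + C (β (t + 2)) * (heavyBallPoly α β (t + 1) - heavyBallPoly α β t)

/-! ### The parameters of the ν-method -/

/-- The step-sizes `α_t` (`t ≥ 1`) of the ν-method, with normalization constant `K`: they are
adapted to operators `Σ̂` of norm at most `K ^ 2`. -/
noncomputable def nuAlpha (ν K : ℝ) (t : ℕ) : ℝ :=
  4 / K ^ 2 * (((2 * (t : ℝ) + 2 * ν - 1) * ((t : ℝ) + ν - 1)) /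
    (((t : ℝ) + 2 * ν - 1) * (2 * (t : ℝ) + 4 * ν - 1)))

/-- The momentum parameters `β_t` (`t ≥ 1`) of the ν-method. -/
noncomputable def nuBeta (ν : ℝ) (t : ℕ) : ℝ :=
  (((t : ℝ) - 1) * (2 * (t : ℝ) - 3) * (2 * (t : ℝ) + 2 * ν - 1)) /
    (((t : ℝ) + 2 * ν - 1) * (2 * (t : ℝ) + 4 * ν - 1) * (2 * (t : ℝ) + 2 * ν - 3))

/-- The initial values `α_1` and `β_1`. -/
theorem nuAlpha_one {ν : ℝ} (hν : 0 < ν) (K : ℝ) :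
    nuAlpha ν K 1 = 1 / K ^ 2 * ((4 * ν + 2) / (4 * ν + 1)) := by
  have h : (4 * ν + 1) ≠ 0 := by positivity
  have e : 4 * (((2 * ((1 : ℕ) : ℝ) + 2 * ν - 1) * (((1 : ℕ) : ℝ) + ν - 1)) /
      ((((1 : ℕ) : ℝ) + 2 * ν - 1) * (2 * ((1 : ℕ) : ℝ) + 4 * ν - 1)))
      = (4 * ν + 2) / (4 * ν + 1) := by
    have h1 : (((1 : ℕ) : ℝ) + 2 * ν - 1) * (2 * ((1 : ℕ) : ℝ) + 4 * ν - 1)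
        = 2 * ν * (4 * ν + 1) := by push_cast; ring
    rw [h1]; push_cast; field_simp; ring
  rw [nuAlpha, ← e]; ring

theorem nuBeta_one (ν : ℝ) : nuBeta ν 1 = 0 := by simp [nuBeta]

/-- The polynomials `g_t` of the ν-method. -/
noncomputable def nuPoly (ν K : ℝ) : ℕ → ℝ[X] := heavyBallPoly (nuAlpha ν K) (nuBeta ν)

/-! ### Spectral filtering functions and qualification

A family of functions is indexed by a type `ι`; `lam i ∈ (0, 1]` is the regularization parameter
of the member `g i`. -/

/-- The residual `r(σ) = 1 - σ g(σ)`. -/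
def residualFn (g : ℝ → ℝ) (σ : ℝ) : ℝ := 1 - σ * g σ

/-- The family `g` is a spectral filtering function on `(0, κ²]` with constants `E` and `F₀`. -/
structure IsSpectralFilter {ι : Type*} (κ : ℝ) (lam : ι → ℝ) (g : ι → ℝ → ℝ) (E F₀ : ℝ) :
    Prop where
  lam_mem : ∀ i, lam i ∈ Set.Ioc (0 : ℝ) 1
  bound : ∀ i, ∀ σ ∈ Set.Ioc (0 : ℝ) (κ ^ 2), |g i σ| ≤ E / lam i
  residual_bound : ∀ i, ∀ σ ∈ Set.Ioc (0 : ℝ) (κ ^ 2), |residualFn (g i) σ| ≤ F₀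

/-- The inequality `sup_{σ ∈ (0, κ²]} |r_λ(σ) σ^q| ≤ F λ^q`, for all parameters `λ` of the family,
with one constant `F`. -/
def QualificationBound {ι : Type*} (κ : ℝ) (lam : ι → ℝ) (g : ι → ℝ → ℝ) (q F : ℝ) : Prop :=
  ∀ i, ∀ σ ∈ Set.Ioc (0 : ℝ) (κ ^ 2), |residualFn (g i) σ * σ ^ q| ≤ F * lam i ^ q

/-- The qualification of the family `g` is `q`: the largest exponent for which the qualification
inequality holds with some constant. -/
def HasQualification {ι : Type*} (κ : ℝ) (lam : ι → ℝ) (g : ι → ℝ → ℝ) (q : ℝ) : Prop :=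
  IsGreatest {p : ℝ | 0 ≤ p ∧ ∃ F : ℝ, QualificationBound κ lam g p F} q

/-!
The residual polynomials of the ν-method are, with `σ = K² (1 - x²)` and `a = 2ν`, the even
Gegenbauer polynomials `R_{2t}(x) = C_{2t}^{(a)}(x) / C_{2t}^{(a)}(1)`: two steps of their
three-term recurrence give the heavy-ball recurrence with the parameters `α_t`, `β_t`
(`residualFn_nuPoly`). All the bounds are statements about `R_n` on `[0, 1)`.

*Filter bounds.* The generating function `|1 - e^{iθ} z|^{-2a}` is a product of two binomial series,
so `R_n(cos θ)` is a convex combination of the `cos ((i - j) θ)` with `i + j = n` (`cosSum_eq`).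
Hence `|R_n| ≤ 1`, and `1 - R_{2t}(cos θ) ≤ 2 t² sin² θ` because `1 - cos (2kθ) ≤ 2 k² sin² θ`; the
second bound is `σ g_t(σ) ≤ 2 t² σ / K²`.

*Qualification.* The function `u(θ) = (sin θ)^a R_n(cos θ)` satisfies `u'' + φ u = 0` with
`φ = (n + a)² + a (1 - a) / sin² θ`. Both energies `u'² + φ u²` and `u² + u'² / φ` are monotone on
`(0, π/2]` where `φ > 0`, in opposite directions that depend on the sign of `1 - a`. At `θ = π/2`, for `n = 2t`,
they are determined by `R_{2t}(0)`, which is of exact order `t^{-a}` by its product formula. One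
energy (for `a > 1` together with `|R_{2t}| ≤ 1` near `θ = 0`, where `φ` may be negative) bounds
`|u|` by a multiple of `t^{-a}` (`exists_rpow_mul_gegenbauer_sq_le`), which is the qualification
inequality with exponent `ν`. The other one shows that `R_{2t}` and its derivative
cannot both be `o(t^{-a})` at an interior point (`mul_gegenbauer_eval_zero_sq_le`). If a larger
exponent qualified, `R_{2t}` would be that small on a whole interval, and by the mean value theorem
its derivative would be small at some point of it (`not_gegenbauer_eval_le_rpow`).
-/

/-! ### Normalized Gegenbauer polynomials -/

/-- The Gegenbauer (ultraspherical) polynomials `C_n^{(a)} / C_n^{(a)}(1)` of parameter `a`,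
normalized to take the value `1` at `1`, defined by their three-term recurrence. -/
noncomputable def gegenbauer (a : ℝ) : ℕ → ℝ[X]
  | 0 => 1
  | 1 => X
  | n + 2 =>
      C (2 * ((n : ℝ) + 1 + a) / ((n : ℝ) + 1 + 2 * a)) * X * gegenbauer a (n + 1)
        - C (((n : ℝ) + 1) / ((n : ℝ) + 1 + 2 * a)) * gegenbauer a n

theorem gegenbauer_eval_add_two {a : ℝ} (ha : 0 < a) (n : ℕ) (x : ℝ) :
    ((n : ℝ) + 1 + 2 * a) * (gegenbauer a (n + 2)).eval x =
      2 * ((n : ℝ) + 1 + a) * x * (gegenbauer a (n + 1)).eval x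
        - ((n : ℝ) + 1) * (gegenbauer a n).eval x := by
  have h : ((n : ℝ) + 1 + 2 * a) ≠ 0 := by positivity
  simp only [gegenbauer, eval_sub, eval_mul, eval_C, eval_X]
  field_simp

theorem gegenbauer_derivative_eval_add_two {a : ℝ} (ha : 0 < a) (n : ℕ) (x : ℝ) :
    ((n : ℝ) + 1 + 2 * a) * (derivative (gegenbauer a (n + 2))).eval x =
      2 * ((n : ℝ) + 1 + a) * ((gegenbauer a (n + 1)).eval x
          + x * (derivative (gegenbauer a (n + 1))).eval x)
        - ((n : ℝ) + 1) * (derivative (gegenbauer a n)).eval x := by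
  have h : ((n : ℝ) + 1 + 2 * a) ≠ 0 := by positivity
  simp only [gegenbauer, derivative_sub, derivative_mul, derivative_C, derivative_X, eval_sub,
    eval_mul, eval_add, eval_C, eval_X, eval_zero, eval_one]
  field_simp
  ring

/-- The two first-order relations between neighbouring Gegenbauer polynomials. The first for `n` is
the second for `n + 1`, rewritten by the three-term recurrence, so they are proved together. -/
theorem gegenbauer_structure {a : ℝ} (ha : 0 < a) (n : ℕ) (x : ℝ) :
    (1 - x ^ 2) * (derivative (gegenbauer a (n + 1))).eval x =
        ((n : ℝ) + 1) * ((gegenbauer a n).eval x - x * (gegenbauer a (n + 1)).eval x) ∧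
      (1 - x ^ 2) * (derivative (gegenbauer a n)).eval x =
        ((n : ℝ) + 2 * a) * (x * (gegenbauer a n).eval x - (gegenbauer a (n + 1)).eval x) := by
  induction n with
  | zero => simp [gegenbauer]; ring
  | succ n ih =>
    obtain ⟨h1, h2⟩ := ih
    have hr := gegenbauer_eval_add_two ha n x
    have hd := gegenbauer_derivative_eval_add_two ha n x
    have h : ((n : ℝ) + 1 + 2 * a) ≠ 0 := by positivity
    push_cast
    constructor
    · apply mul_left_cancel₀ h
      linear_combination (1 - x ^ 2) * hd + 2 * ((n : ℝ) + 1 + a) * x * h1 - ((n : ℝ) + 1) * h2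
        + ((n : ℝ) + 2) * x * hr
    · linear_combination h1 + hr

theorem gegenbauer_derivative_eval {a : ℝ} (ha : 0 < a) (n : ℕ) (x : ℝ) :
    (1 - x ^ 2) * (derivative (gegenbauer a n)).eval x =
        ((n : ℝ) + 2 * a) * (x * (gegenbauer a n).eval x - (gegenbauer a (n + 1)).eval x) :=
  (gegenbauer_structure ha n x).2

/-- The Gegenbauer differential equation. -/
theorem gegenbauer_ode {a : ℝ} (ha : 0 < a) (n : ℕ) {x : ℝ} (hx : 1 - x ^ 2 ≠ 0) :
    (1 - x ^ 2) * (derivative (derivative (gegenbauer a n))).eval x =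
      (2 * a + 1) * x * (derivative (gegenbauer a n)).eval x
        - n * (n + 2 * a) * (gegenbauer a n).eval x := by
  have hp : (1 - X ^ 2) * derivative (gegenbauer a n) =
      C ((n : ℝ) + 2 * a) * (X * gegenbauer a n - gegenbauer a (n + 1)) := by
    apply Polynomial.funext
    intro y
    simpa using (gegenbauer_structure ha n y).2
  have hd := congrArg (fun p => (derivative p).eval x) hp
  simp only [derivative_mul, derivative_sub, derivative_one, derivative_X_pow, derivative_C,
    derivative_X, eval_add, eval_mul, eval_sub, eval_pow, eval_X, eval_C, eval_one, eval_zero]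
    at hd
  obtain ⟨h1, h2⟩ := gegenbauer_structure ha n x
  apply mul_left_cancel₀ hx
  norm_num at hd
  linear_combination (1 - x ^ 2) * hd - ((n : ℝ) + 2 * a) * h1 + ((n : ℝ) + 1) * x * h2

/-- Three steps of the recurrence combine to one between polynomials of equal parity. -/
theorem gegenbauer_eval_add_four {a : ℝ} (ha : 0 < a) (n : ℕ) (x : ℝ) :
    ((n : ℝ) + 2 + 2 * a) * ((n : ℝ) + 3 + 2 * a) * ((n : ℝ) + 1 + a)
        * ((gegenbauer a (n + 4)).eval x - (gegenbauer a (n + 2)).eval x) =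
      -4 * ((n : ℝ) + 3 + a) * ((n : ℝ) + 2 + a) * ((n : ℝ) + 1 + a) * (1 - x ^ 2)
          * (gegenbauer a (n + 2)).eval x
        + ((n : ℝ) + 3 + a) * ((n : ℝ) + 2) * ((n : ℝ) + 1)
          * ((gegenbauer a (n + 2)).eval x - (gegenbauer a n).eval x) := by
  have h0 := gegenbauer_eval_add_two ha n x
  have h1 := gegenbauer_eval_add_two ha (n + 1) x
  have h2 := gegenbauer_eval_add_two ha (n + 2) x
  push_cast at h1 h2
  linear_combination ((n : ℝ) + 2 + 2 * a) * ((n : ℝ) + 1 + a) * h2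
    + 2 * ((n : ℝ) + 3 + a) * ((n : ℝ) + 1 + a) * x * h1 + ((n : ℝ) + 3 + a) * ((n : ℝ) + 2) * h0

/-! ### The residuals of the ν-method -/

/-- The residual polynomials of the ν-method are the even Gegenbauer polynomials of parameter `2ν`
in the variable `x` with `σ = K² (1 - x²)`. -/
theorem residualFn_nuPoly {ν K : ℝ} (hν : 0 < ν) (hK : 0 < K) (x : ℝ) (t : ℕ) :
    residualFn (fun σ => (nuPoly ν K t).eval σ) (K ^ 2 * (1 - x ^ 2)) =
      (gegenbauer (2 * ν) (2 * t)).eval x := by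
  have ha : 0 < 2 * ν := by positivity
  have hK0 : K ≠ 0 := hK.ne'
  induction t using Nat.twoStepInduction with
  | zero => simp [residualFn, nuPoly, heavyBallPoly, gegenbauer]
  | one =>
    have h : 1 + 2 * (2 * ν) ≠ 0 := by positivity
    have h' : 4 * ν + 1 ≠ 0 := by positivity
    simp [residualFn, nuPoly, heavyBallPoly, gegenbauer, nuAlpha_one hν]
    field_simp
    ring
  | more t ih0 ih1 =>
    have hr := gegenbauer_eval_add_four ha (2 * t) x
    have e1 : 2 * (t + 1) = 2 * t + 2 := by ring
    have e2 : 2 * (t + 2) = 2 * t + 4 := by ring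
    rw [e1] at ih1
    rw [e2]
    simp only [residualFn, nuPoly] at ih0 ih1 ⊢
    simp only [heavyBallPoly, eval_add, eval_sub, eval_mul, eval_C, eval_X, eval_one]
    set s := 1 - x ^ 2
    set G0 := (heavyBallPoly (nuAlpha ν K) (nuBeta ν) t).eval (K ^ 2 * s)
    set G1 := (heavyBallPoly (nuAlpha ν K) (nuBeta ν) (t + 1)).eval (K ^ 2 * s)
    rw [← ih0, ← ih1] at hr
    set R := (gegenbauer (2 * ν) (2 * t + 4)).eval x
    push_cast at hr
    have ht : (0 : ℝ) ≤ t := Nat.cast_nonneg t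
    have d1 : 2 * (t : ℝ) + 2 + 2 * (2 * ν) ≠ 0 := by positivity
    have d2 : 2 * (t : ℝ) + 3 + 2 * (2 * ν) ≠ 0 := by positivity
    have d3 : 2 * (t : ℝ) + 1 + 2 * ν ≠ 0 := by positivity
    have hα : nuAlpha ν K (t + 2) * K ^ 2 =
        4 * ((2 * (t : ℝ) + 3 + 2 * ν) * (2 * (t : ℝ) + 2 + 2 * ν)) /
          ((2 * (t : ℝ) + 2 + 2 * (2 * ν)) * (2 * (t : ℝ) + 3 + 2 * (2 * ν))) := by
      have k1 : (t : ℝ) + 2 + 2 * ν - 1 ≠ 0 := by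
        have : 0 < (t : ℝ) + 2 + 2 * ν - 1 := by linarith
        exact this.ne'
      have k2 : 2 * ((t : ℝ) + 2) + 4 * ν - 1 ≠ 0 := by
        have : 0 < 2 * ((t : ℝ) + 2) + 4 * ν - 1 := by linarith
        exact this.ne'
      simp only [nuAlpha]
      push_cast
      field_simp
      ring
    have hβ : nuBeta ν (t + 2) =
        ((2 * (t : ℝ) + 3 + 2 * ν) * (2 * (t : ℝ) + 2) * (2 * (t : ℝ) + 1)) /
          ((2 * (t : ℝ) + 2 + 2 * (2 * ν)) * (2 * (t : ℝ) + 3 + 2 * (2 * ν))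
            * (2 * (t : ℝ) + 1 + 2 * ν)) := by
      have k1 : (t : ℝ) + 2 + 2 * ν - 1 ≠ 0 := by
        have : 0 < (t : ℝ) + 2 + 2 * ν - 1 := by linarith
        exact this.ne'
      have k2 : 2 * ((t : ℝ) + 2) + 4 * ν - 1 ≠ 0 := by
        have : 0 < 2 * ((t : ℝ) + 2) + 4 * ν - 1 := by linarith
        exact this.ne'
      have k3 : 2 * ((t : ℝ) + 2) + 2 * ν - 3 ≠ 0 := by
        have : 0 < 2 * ((t : ℝ) + 2) + 2 * ν - 3 := by linarith
        exact this.ne'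
      simp only [nuBeta]
      push_cast
      rw [div_eq_div_iff (mul_ne_zero (mul_ne_zero k1 k2) k3) (mul_ne_zero (mul_ne_zero d1 d2) d3)]
      ring
    have hα' := (eq_div_iff (mul_ne_zero d1 d2)).1 hα
    have hβ' := (eq_div_iff (mul_ne_zero (mul_ne_zero d1 d2) d3)).1 hβ
    apply mul_left_cancel₀ (mul_ne_zero (mul_ne_zero d1 d2) d3)
    linear_combination -hr - (2 * (t : ℝ) + 1 + 2 * ν) * s * (1 - K ^ 2 * s * G1) * hα'
      - K ^ 2 * s * (G1 - G0) * hβ'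

/-! ### The cosine expansion with positive coefficients -/

/-- The coefficients `(a)_i / i!` of the binomial series `(1 - z)⁻ᵃ`. -/
noncomputable def binomCoeff (a : ℝ) : ℕ → ℝ
  | 0 => 1
  | i + 1 => (a + i) / (i + 1) * binomCoeff a i

theorem binomCoeff_pos {a : ℝ} (ha : 0 < a) (i : ℕ) : 0 < binomCoeff a i := by
  induction i with
  | zero => simp [binomCoeff]
  | succ i ih => rw [binomCoeff]; positivity

/-- The binomial series `(1 - w z)⁻ᵃ` in `z`. -/
noncomputable def binomSeries (a : ℝ) (w : ℂ) : PowerSeries ℂ :=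
  PowerSeries.mk fun i => (binomCoeff a i : ℂ) * w ^ i

theorem binomSeries_ode (a : ℝ) (w : ℂ) :
    (1 - PowerSeries.C w * PowerSeries.X) * PowerSeries.derivative ℂ (binomSeries a w) =
      PowerSeries.C (a * w) * binomSeries a w := by
  ext i
  have hc : ∀ i : ℕ, (binomCoeff a (i + 1) : ℂ) * (i + 1) = (a + i) * binomCoeff a i := by
    intro i
    have h : (i : ℂ) + 1 ≠ 0 := by exact_mod_cast Nat.succ_ne_zero i
    rw [binomCoeff]
    push_cast
    field_simp
  rw [sub_mul, one_mul, mul_assoc, map_sub, PowerSeries.coeff_C_mul, PowerSeries.coeff_C_mul]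
  cases i with
  | zero =>
    have := hc 0
    simp [PowerSeries.coeff_derivative, binomSeries] at this ⊢
    linear_combination w * this
  | succ i =>
    rw [PowerSeries.coeff_succ_X_mul]
    have h1 := hc (i + 1)
    simp only [PowerSeries.coeff_derivative, binomSeries, PowerSeries.coeff_mk] at h1 ⊢
    push_cast at h1 ⊢
    linear_combination w ^ (i + 2) * h1

/-- The cosine polynomial `∑_{i+j=n} (a)_i (a)_j / (i! j!) cos ((i - j) θ)`, the Gegenbauer
polynomial in its classical normalization. -/
noncomputable def cosSum (a : ℝ) (n : ℕ) (θ : ℝ) : ℝ :=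
  ∑ p ∈ Finset.HasAntidiagonal.antidiagonal n,
    binomCoeff a p.1 * binomCoeff a p.2 * Real.cos (((p.1 : ℝ) - p.2) * θ)

theorem re_coeff_binomSeries_mul (a : ℝ) (n : ℕ) (θ : ℝ) :
    (PowerSeries.coeff n (binomSeries a (Complex.exp (θ * Complex.I))
      * binomSeries a (Complex.exp (-(θ * Complex.I))))).re = cosSum a n θ := by
  rw [PowerSeries.coeff_mul, cosSum, Complex.re_sum]
  refine Finset.sum_congr rfl fun p _ => ?_
  simp only [binomSeries, PowerSeries.coeff_mk]
  rw [← Complex.exp_nat_mul, ← Complex.exp_nat_mul]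
  have : (binomCoeff a p.1 : ℂ) * Complex.exp (p.1 * (θ * Complex.I))
      * ((binomCoeff a p.2 : ℂ) * Complex.exp (p.2 * -(θ * Complex.I)))
      = ((binomCoeff a p.1 * binomCoeff a p.2 : ℝ) : ℂ)
        * Complex.exp (((((p.1 : ℝ) - p.2) * θ : ℝ) : ℂ) * Complex.I) := by
    rw [mul_mul_mul_comm, ← Complex.exp_add]
    push_cast
    ring_nf
  rw [this, Complex.re_ofReal_mul, Complex.exp_ofReal_mul_I_re]

/-- The recurrence expresses that the generating function `|1 - e^{iθ} z|^{-2a}` of the cosine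
polynomials satisfies `(1 - 2 cos θ z + z²) G' = 2a (cos θ - z) G`. -/
theorem cosSum_add_two (a : ℝ) (n : ℕ) (θ : ℝ) :
    ((n : ℝ) + 2) * cosSum a (n + 2) θ =
      2 * ((n : ℝ) + 1 + a) * Real.cos θ * cosSum a (n + 1) θ
        - ((n : ℝ) + 2 * a) * cosSum a n θ := by
  set w := Complex.exp (θ * Complex.I)
  set v := Complex.exp (-(θ * Complex.I))
  have hwv : w * v = 1 := by rw [← Complex.exp_add]; simp
  have hs : w + v = (2 * Real.cos θ : ℝ) := by
    push_cast
    rw [Complex.cos]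
    simp only [w, v]
    ring_nf
  set G := binomSeries a w * binomSeries a v
  have hG : (1 - PowerSeries.C (w + v) * PowerSeries.X + PowerSeries.X * PowerSeries.X)
      * PowerSeries.derivative ℂ G
      = PowerSeries.C (a * (w + v)) * G - PowerSeries.C (2 * (a : ℂ)) * PowerSeries.X * G := by
    have hA := binomSeries_ode a w
    have hB := binomSeries_ode a v
    have hC : PowerSeries.C w * PowerSeries.C v = (1 : PowerSeries ℂ) := by
      rw [← map_mul, hwv, map_one]
    have h2 : PowerSeries.C (2 * (a : ℂ)) = 2 * PowerSeries.C (a : ℂ) := by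
      rw [map_mul, map_ofNat]
    simp only [G, Derivation.leibniz, smul_eq_mul, map_mul, map_add] at hA hB h2 ⊢
    rw [h2]
    set A := binomSeries a w
    set B := binomSeries a v
    set A' := PowerSeries.derivative ℂ A
    set B' := PowerSeries.derivative ℂ B
    set Cw := PowerSeries.C w
    set Cv := PowerSeries.C v
    linear_combination (1 - Cv * PowerSeries.X) * B * hA + (1 - Cw * PowerSeries.X) * A * hB
      - (PowerSeries.X ^ 2 * (A * B' + B * A') + 2 * PowerSeries.C (a : ℂ) * PowerSeries.X * A * B)
        * hC
  have hn := congrArg (PowerSeries.coeff (n + 1)) hG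
  have hd : ∀ m : ℕ, PowerSeries.coeff m (PowerSeries.derivative ℂ G)
      = PowerSeries.coeff (m + 1) G * ((m : ℂ) + 1) := fun m => by
    rw [PowerSeries.coeff_derivative]
  rw [add_mul, sub_mul, one_mul, map_add, map_sub, map_sub, mul_assoc, mul_assoc, mul_assoc,
    PowerSeries.coeff_C_mul, PowerSeries.coeff_C_mul, PowerSeries.coeff_C_mul,
    PowerSeries.coeff_succ_X_mul, PowerSeries.coeff_succ_X_mul, PowerSeries.coeff_succ_X_mul,
    hd, hd, hs] at hn
  have hx : PowerSeries.coeff n (PowerSeries.X * PowerSeries.derivative ℂ G)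
      = PowerSeries.coeff n G * n := by
    cases n with
    | zero => simp
    | succ m => rw [PowerSeries.coeff_succ_X_mul, hd]; push_cast; rfl
  rw [hx] at hn
  have hre := congrArg Complex.re (show
      ((((n : ℝ) + 2 : ℝ)) : ℂ) * PowerSeries.coeff (n + 2) G
      = ((2 * ((n : ℝ) + 1 + a) * Real.cos θ : ℝ) : ℂ) * PowerSeries.coeff (n + 1) G
        - (((n : ℝ) + 2 * a : ℝ) : ℂ) * PowerSeries.coeff n G by
    push_cast at hn ⊢
    linear_combination hn)
  rw [Complex.sub_re, Complex.re_ofReal_mul, Complex.re_ofReal_mul, Complex.re_ofReal_mul] at hre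
  simpa only [G, w, v, re_coeff_binomSeries_mul] using hre

theorem cosSum_zero_pos {a : ℝ} (ha : 0 < a) (n : ℕ) : 0 < cosSum a n 0 := by
  refine Finset.sum_pos (fun p _ => ?_) ⟨(0, n), by simp⟩
  simpa using mul_pos (binomCoeff_pos ha p.1) (binomCoeff_pos ha p.2)

theorem cosSum_zero_succ (a : ℝ) (n : ℕ) :
    ((n : ℝ) + 1) * cosSum a (n + 1) 0 = ((n : ℝ) + 2 * a) * cosSum a n 0 := by
  induction n with
  | zero =>
    simp [cosSum, Finset.Nat.antidiagonal_succ, binomCoeff]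
    ring
  | succ n ih =>
    have h := cosSum_add_two a n 0
    rw [Real.cos_zero] at h
    push_cast
    linear_combination h + ih

theorem cosSum_eq {a : ℝ} (ha : 0 < a) (n : ℕ) (θ : ℝ) :
    cosSum a n θ = cosSum a n 0 * (gegenbauer a n).eval (Real.cos θ) := by
  induction n using Nat.twoStepInduction with
  | zero => simp [cosSum, gegenbauer]
  | one =>
    simp [cosSum, Finset.Nat.antidiagonal_succ, binomCoeff, gegenbauer]
    ring
  | more n ih0 ih1 =>
    have h := cosSum_add_two a n θ
    have hg := gegenbauer_eval_add_two ha n (Real.cos θ)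
    have k0 := cosSum_zero_succ a n
    have k1 := cosSum_zero_succ a (n + 1)
    have hn : (n : ℝ) + 2 ≠ 0 := by positivity
    push_cast at k1
    rw [ih0, ih1] at h
    apply mul_left_cancel₀ hn
    linear_combination h - (gegenbauer a (n + 2)).eval (Real.cos θ) * k1
      - cosSum a (n + 1) 0 * hg + (gegenbauer a n).eval (Real.cos θ) * k0

theorem abs_gegenbauer_eval_cos_le {a : ℝ} (ha : 0 < a) (n : ℕ) (θ : ℝ) :
    |(gegenbauer a n).eval (Real.cos θ)| ≤ 1 := by
  have hp := cosSum_zero_pos ha n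
  have h : |cosSum a n θ| ≤ cosSum a n 0 := by
    refine (Finset.abs_sum_le_sum_abs _ _).trans (Finset.sum_le_sum fun p _ => ?_)
    have := mul_pos (binomCoeff_pos ha p.1) (binomCoeff_pos ha p.2)
    rw [abs_mul, abs_of_pos this, mul_zero, Real.cos_zero]
    exact mul_le_mul_of_nonneg_left (Real.abs_cos_le_one _) this.le
  rw [cosSum_eq ha, abs_mul, abs_of_pos hp] at h
  exact le_of_mul_le_mul_left (by linarith) hp

theorem abs_sin_nat_mul_le (k : ℕ) (θ : ℝ) : |Real.sin (k * θ)| ≤ k * |Real.sin θ| := by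
  induction k with
  | zero => simp
  | succ k ih =>
    push_cast
    rw [add_mul, one_mul, Real.sin_add]
    refine (abs_add_le _ _).trans ?_
    rw [abs_mul, abs_mul]
    have h1 := mul_le_mul ih (Real.abs_cos_le_one θ) (abs_nonneg _) (by positivity)
    have h2 := mul_le_mul_of_nonneg_right (Real.abs_cos_le_one (k * θ)) (abs_nonneg (Real.sin θ))
    linarith

/-- A term of the cosine expansion of even degree deviates from its value at `0` by
`1 - cos (2 k θ) = 2 sin² (k θ) ≤ 2 k² sin² θ` with `|k| ≤ t`. -/
theorem one_sub_gegenbauer_eval_cos_le {a : ℝ} (ha : 0 < a) (t : ℕ) (θ : ℝ) :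
    1 - (gegenbauer a (2 * t)).eval (Real.cos θ) ≤ 2 * (t : ℝ) ^ 2 * Real.sin θ ^ 2 := by
  have hp := cosSum_zero_pos ha (2 * t)
  have h : cosSum a (2 * t) 0 - cosSum a (2 * t) θ
      ≤ 2 * (t : ℝ) ^ 2 * Real.sin θ ^ 2 * cosSum a (2 * t) 0 := by
    rw [cosSum, cosSum, ← Finset.sum_sub_distrib, Finset.mul_sum]
    refine Finset.sum_le_sum fun p hpm => ?_
    have hb := mul_pos (binomCoeff_pos ha p.1) (binomCoeff_pos ha p.2)
    rw [Finset.HasAntidiagonal.mem_antidiagonal] at hpm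
    obtain ⟨k, hk, hkc⟩ : ∃ k : ℕ, k ≤ t ∧
        Real.cos (((p.1 : ℝ) - p.2) * θ) = Real.cos (2 * (k * θ)) := by
      rcases le_total p.1 p.2 with hle | hle
      · refine ⟨t - p.1, by omega, ?_⟩
        rw [← Real.cos_neg]
        have h1 : (p.1 : ℝ) ≤ t := by exact_mod_cast (by omega : p.1 ≤ t)
        have h2 : (p.1 : ℝ) + p.2 = 2 * t := by exact_mod_cast hpm
        rw [Nat.cast_sub (by omega)]
        congr 1
        linear_combination θ * h2
      · refine ⟨t - p.2, by omega, ?_⟩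
        have h2 : (p.1 : ℝ) + p.2 = 2 * t := by exact_mod_cast hpm
        rw [Nat.cast_sub (by omega)]
        congr 1
        linear_combination θ * h2
    have hs : Real.sin (k * θ) ^ 2 ≤ (t : ℝ) ^ 2 * Real.sin θ ^ 2 := by
      rw [← sq_abs (Real.sin (k * θ)), ← sq_abs (Real.sin θ), ← mul_pow]
      have hkt : (k : ℝ) ≤ t := by exact_mod_cast hk
      exact pow_le_pow_left₀ (abs_nonneg _) ((abs_sin_nat_mul_le k θ).trans
        (mul_le_mul_of_nonneg_right hkt (abs_nonneg _))) 2
    have hc : 1 - Real.cos (2 * (k * θ)) ≤ 2 * (t : ℝ) ^ 2 * Real.sin θ ^ 2 := by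
      rw [Real.cos_two_mul']
      have := Real.sin_sq_add_cos_sq (k * θ)
      linarith
    rw [hkc, mul_zero, Real.cos_zero]
    have := mul_le_mul_of_nonneg_left hc hb.le
    linarith
  rw [cosSum_eq ha (2 * t) θ] at h
  refine le_of_mul_le_mul_left ?_ hp
  linarith

/-! ### Two energies -/

/-- In the variable `x = cos θ`, up to the sign and the factor `(sin θ)^(a-1)`, the derivative in
`θ` of `(sin θ)^a R(cos θ)`, where `R` is the Gegenbauer polynomial. -/
noncomputable def gegenbauerFlux (a : ℝ) (n : ℕ) (x : ℝ) : ℝ :=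
  (1 - x ^ 2) * (derivative (gegenbauer a n)).eval x - a * x * (gegenbauer a n).eval x

/-- `sin² θ` times the potential `(n + a)² + a (1 - a) / sin² θ` of the equation `u'' + φ u = 0`
satisfied by `u = (sin θ)^a R(cos θ)`, in the variable `x = cos θ`. -/
noncomputable def gegenbauerPotential (a : ℝ) (n : ℕ) (x : ℝ) : ℝ :=
  ((n : ℝ) + a) ^ 2 * (1 - x ^ 2) + a * (1 - a)

/-- The energy `u'² + φ u²` of `u = (sin θ)^a R(cos θ)`. -/
noncomputable def gegenbauerEnergy (a : ℝ) (n : ℕ) (x : ℝ) : ℝ :=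
  (1 - x ^ 2) ^ (a - 1) *
    (gegenbauerFlux a n x ^ 2 + gegenbauerPotential a n x * (gegenbauer a n).eval x ^ 2)

/-- The energy `u² + u'² / φ` of `u = (sin θ)^a R(cos θ)`. -/
noncomputable def gegenbauerSonin (a : ℝ) (n : ℕ) (x : ℝ) : ℝ :=
  (1 - x ^ 2) ^ a *
    (gegenbauerFlux a n x ^ 2 / gegenbauerPotential a n x + (gegenbauer a n).eval x ^ 2)

section Energy

variable {a : ℝ} {n : ℕ} {x y : ℝ}

theorem hasDerivAt_gegenbauerFlux (ha : 0 < a) (hx : 0 < 1 - x ^ 2) :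
    HasDerivAt (gegenbauerFlux a n)
      (((a - 1) * x * gegenbauerFlux a n x
        - gegenbauerPotential a n x * (gegenbauer a n).eval x) / (1 - x ^ 2)) x := by
  have h := ((((hasDerivAt_pow 2 x).const_sub 1).mul
    ((derivative (gegenbauer a n)).hasDerivAt x)).sub
    (((hasDerivAt_id x).const_mul a).mul ((gegenbauer a n).hasDerivAt x)))
  refine HasDerivAt.congr_deriv (f := gegenbauerFlux a n) h ?_
  rw [eq_div_iff hx.ne']
  have ho := gegenbauer_ode ha n hx.ne'
  simp only [gegenbauerFlux, gegenbauerPotential, id]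
  norm_num
  linear_combination (1 - x ^ 2) * ho

theorem hasDerivAt_gegenbauerPotential :
    HasDerivAt (gegenbauerPotential a n) (-2 * x * ((n : ℝ) + a) ^ 2) x := by
  have h := (((hasDerivAt_pow 2 x).const_sub 1).const_mul (((n : ℝ) + a) ^ 2)).add_const
    (a * (1 - a))
  refine HasDerivAt.congr_deriv (f := gegenbauerPotential a n) h ?_
  norm_num
  ring

theorem hasDerivAt_gegenbauerEnergy (ha : 0 < a) (hx : 0 < 1 - x ^ 2) :
    HasDerivAt (gegenbauerEnergy a n)
      (2 * x * (a * (1 - a)) * (1 - x ^ 2) ^ (a - 2) * (gegenbauer a n).eval x ^ 2) x := by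
  have hs : HasDerivAt (fun y : ℝ => (1 - y ^ 2) ^ (a - 1)) _ x :=
    ((hasDerivAt_pow 2 x).const_sub 1).rpow_const (p := a - 1) (Or.inl hx.ne')
  have h := hs.mul (((hasDerivAt_gegenbauerFlux (n := n) ha hx).pow 2).add
    ((hasDerivAt_gegenbauerPotential (a := a) (n := n) (x := x)).mul
      (((gegenbauer a n).hasDerivAt x).pow 2)))
  refine HasDerivAt.congr_deriv (f := gegenbauerEnergy a n) h ?_
  have e1 : (1 - x ^ 2) ^ (a - 1) = (1 - x ^ 2) ^ (a - 2) * (1 - x ^ 2) := by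
    rw [← Real.rpow_add_one hx.ne']
    ring_nf
  have e2 : a - 1 - 1 = a - 2 := by ring
  have hV : (1 - x ^ 2) * (derivative (gegenbauer a n)).eval x =
      gegenbauerFlux a n x + a * x * (gegenbauer a n).eval x := by
    simp only [gegenbauerFlux]; ring
  have hQ : gegenbauerPotential a n x = ((n : ℝ) + a) ^ 2 * (1 - x ^ 2) + a * (1 - a) := rfl
  simp only [e2, e1, Pi.add_apply, Pi.pow_apply, Pi.mul_apply]
  norm_num
  set V := gegenbauerFlux a n x
  set Q := gegenbauerPotential a n x
  set R := (gegenbauer a n).eval x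
  set R' := (derivative (gegenbauer a n)).eval x
  set p := (1 - x ^ 2) ^ (a - 2)
  field_simp
  linear_combination p * Q * R * hV + p * x * R ^ 2 * hQ

theorem hasDerivAt_gegenbauerSonin (ha : 0 < a) (hx : 0 < 1 - x ^ 2)
    (hQ0 : 0 < gegenbauerPotential a n x) :
    HasDerivAt (gegenbauerSonin a n)
      (-(2 * x * (a * (1 - a)) * (1 - x ^ 2) ^ (a - 1) * gegenbauerFlux a n x ^ 2
        / gegenbauerPotential a n x ^ 2)) x := by
  have hs : HasDerivAt (fun y : ℝ => (1 - y ^ 2) ^ a) _ x :=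
    ((hasDerivAt_pow 2 x).const_sub 1).rpow_const (p := a) (Or.inl hx.ne')
  have h := hs.mul ((((hasDerivAt_gegenbauerFlux (n := n) ha hx).pow 2).div
    (hasDerivAt_gegenbauerPotential (a := a) (n := n) (x := x)) hQ0.ne').add
      (((gegenbauer a n).hasDerivAt x).pow 2))
  refine HasDerivAt.congr_deriv (f := gegenbauerSonin a n) h ?_
  have e1 : (1 - x ^ 2) ^ a = (1 - x ^ 2) ^ (a - 1) * (1 - x ^ 2) := by
    rw [← Real.rpow_add_one hx.ne']
    ring_nf
  have hV : (1 - x ^ 2) * (derivative (gegenbauer a n)).eval x =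
      gegenbauerFlux a n x + a * x * (gegenbauer a n).eval x := by
    simp only [gegenbauerFlux]; ring
  have hQ : gegenbauerPotential a n x = ((n : ℝ) + a) ^ 2 * (1 - x ^ 2) + a * (1 - a) := rfl
  simp only [e1, Pi.add_apply, Pi.pow_apply, Pi.div_apply]
  norm_num
  set V := gegenbauerFlux a n x
  set Q := gegenbauerPotential a n x
  set R := (gegenbauer a n).eval x
  set R' := (derivative (gegenbauer a n)).eval x
  set p := (1 - x ^ 2) ^ (a - 1)
  have hQ0' : Q ≠ 0 := hQ0.ne'
  field_simp
  linear_combination p * Q ^ 2 * R * hV - p * x * V ^ 2 * hQ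

theorem one_sub_sq_pos_of_mem (hy : y < 1) {x : ℝ} (hx : x ∈ Set.Icc 0 y) : 0 < 1 - x ^ 2 := by
  nlinarith [hx.1, hx.2]

theorem gegenbauerPotential_le (hx : x ∈ Set.Icc 0 y) :
    gegenbauerPotential a n y ≤ gegenbauerPotential a n x := by
  have : x ^ 2 ≤ y ^ 2 := pow_le_pow_left₀ hx.1 hx.2 2
  have := mul_le_mul_of_nonneg_left this (sq_nonneg ((n : ℝ) + a))
  simp only [gegenbauerPotential]
  linarith

theorem gegenbauerEnergy_zero_le (ha : 0 < a) (ha1 : a ≤ 1) (hy0 : 0 ≤ y) (hy : y < 1) :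
    gegenbauerEnergy a n 0 ≤ gegenbauerEnergy a n y := by
  refine monotoneOn_of_hasDerivWithinAt_nonneg (convex_Icc 0 y)
    (fun x hx => ((hasDerivAt_gegenbauerEnergy ha
      (one_sub_sq_pos_of_mem hy hx)).continuousAt.continuousWithinAt))
    (fun x hx => (hasDerivAt_gegenbauerEnergy ha
      (one_sub_sq_pos_of_mem hy (interior_subset hx))).hasDerivWithinAt)
    (fun x hx => ?_) ⟨le_rfl, hy0⟩ ⟨hy0, le_rfl⟩ hy0
  have h1 := (interior_subset hx).1
  have h2 := one_sub_sq_pos_of_mem hy (interior_subset hx)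
  have h3 : 0 ≤ 1 - a := by linarith
  positivity

theorem gegenbauerEnergy_le_zero (ha : 1 ≤ a) (hy0 : 0 ≤ y) (hy : y < 1) :
    gegenbauerEnergy a n y ≤ gegenbauerEnergy a n 0 := by
  have ha0 : 0 < a := by linarith
  refine antitoneOn_of_hasDerivWithinAt_nonpos (convex_Icc 0 y)
    (fun x hx => ((hasDerivAt_gegenbauerEnergy ha0
      (one_sub_sq_pos_of_mem hy hx)).continuousAt.continuousWithinAt))
    (fun x hx => (hasDerivAt_gegenbauerEnergy ha0
      (one_sub_sq_pos_of_mem hy (interior_subset hx))).hasDerivWithinAt)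
    (fun x hx => ?_) ⟨le_rfl, hy0⟩ ⟨hy0, le_rfl⟩ hy0
  have h1 := (interior_subset hx).1
  have h2 := one_sub_sq_pos_of_mem hy (interior_subset hx)
  have h3 : 0 ≤ a - 1 := by linarith
  have : 0 ≤ 2 * x * (a * (a - 1)) * (1 - x ^ 2) ^ (a - 2) * (gegenbauer a n).eval x ^ 2 := by
    positivity
  linarith

theorem gegenbauerSonin_le_zero (ha : 0 < a) (ha1 : a ≤ 1) (hy0 : 0 ≤ y) (hy : y < 1)
    (hQ : 0 < gegenbauerPotential a n y) :
    gegenbauerSonin a n y ≤ gegenbauerSonin a n 0 := by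
  refine antitoneOn_of_hasDerivWithinAt_nonpos (convex_Icc 0 y)
    (fun x hx => ((hasDerivAt_gegenbauerSonin ha (one_sub_sq_pos_of_mem hy hx)
      (hQ.trans_le (gegenbauerPotential_le hx))).continuousAt.continuousWithinAt))
    (fun x hx => (hasDerivAt_gegenbauerSonin ha (one_sub_sq_pos_of_mem hy (interior_subset hx))
      (hQ.trans_le (gegenbauerPotential_le (interior_subset hx)))).hasDerivWithinAt)
    (fun x hx => ?_) ⟨le_rfl, hy0⟩ ⟨hy0, le_rfl⟩ hy0
  have h1 := (interior_subset hx).1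
  have h2 := one_sub_sq_pos_of_mem hy (interior_subset hx)
  have h3 : 0 ≤ 1 - a := by linarith
  rw [neg_nonpos]
  positivity

theorem gegenbauerSonin_zero_le (ha : 1 ≤ a) (hy0 : 0 ≤ y) (hy : y < 1)
    (hQ : 0 < gegenbauerPotential a n y) :
    gegenbauerSonin a n 0 ≤ gegenbauerSonin a n y := by
  have ha0 : 0 < a := by linarith
  refine monotoneOn_of_hasDerivWithinAt_nonneg (convex_Icc 0 y)
    (fun x hx => ((hasDerivAt_gegenbauerSonin ha0 (one_sub_sq_pos_of_mem hy hx)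
      (hQ.trans_le (gegenbauerPotential_le hx))).continuousAt.continuousWithinAt))
    (fun x hx => (hasDerivAt_gegenbauerSonin ha0 (one_sub_sq_pos_of_mem hy (interior_subset hx))
      (hQ.trans_le (gegenbauerPotential_le (interior_subset hx)))).hasDerivWithinAt)
    (fun x hx => ?_) ⟨le_rfl, hy0⟩ ⟨hy0, le_rfl⟩ hy0
  have h1 := (interior_subset hx).1
  have h2 := one_sub_sq_pos_of_mem hy (interior_subset hx)
  have h3 : 0 ≤ a - 1 := by linarith
  have : 0 ≤ 2 * x * (a * (a - 1)) * (1 - x ^ 2) ^ (a - 1) * gegenbauerFlux a n x ^ 2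
        / gegenbauerPotential a n x ^ 2 := by
    positivity
  refine this.trans_eq ?_
  ring

end Energy

/-! ### The values at the equator `x = 0` -/

theorem gegenbauer_eval_zero_of_odd (a : ℝ) (t : ℕ) : (gegenbauer a (2 * t + 1)).eval 0 = 0 := by
  induction t with
  | zero => simp [gegenbauer]
  | succ t ih =>
    rw [show 2 * (t + 1) + 1 = 2 * t + 1 + 2 by ring, gegenbauer]
    simp [ih]

theorem gegenbauerFlux_zero_of_even {a : ℝ} (ha : 0 < a) (t : ℕ) :
    gegenbauerFlux a (2 * t) 0 = 0 := by
  have h := gegenbauer_derivative_eval ha (2 * t) 0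
  rw [gegenbauer_eval_zero_of_odd] at h
  simp at h
  simp [gegenbauerFlux, h]

theorem abs_gegenbauer_eval_zero_succ {a : ℝ} (ha : 0 < a) (t : ℕ) :
    |(gegenbauer a (2 * (t + 1))).eval 0| =
      ((t : ℝ) + 1 / 2) / ((t : ℝ) + 1 / 2 + a) * |(gegenbauer a (2 * t)).eval 0| := by
  have h := gegenbauer_eval_add_two ha (2 * t) 0
  rw [show 2 * t + 2 = 2 * (t + 1) by ring] at h
  have hp : (0 : ℝ) < (t : ℝ) + 1 / 2 := by positivity
  have hp2 : (0 : ℝ) < (t : ℝ) + 1 / 2 + a := by positivity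
  have h' : (gegenbauer a (2 * (t + 1))).eval 0 =
      -(((t : ℝ) + 1 / 2) / ((t : ℝ) + 1 / 2 + a) * (gegenbauer a (2 * t)).eval 0) := by
    push_cast at h
    field_simp
    linarith
  rw [h', abs_neg, abs_mul, abs_of_pos (div_pos hp hp2)]

/-- `x / (x + a) ≤ e^{-a / (x + a)} ≤ ((x + a) / (x + a + 1))^a`. -/
theorem div_add_le_rpow {a x : ℝ} (ha : 0 < a) (hx : 0 < x) :
    x / (x + a) * (x + a + 1) ^ a ≤ (x + a) ^ a := by
  have h1 : 0 < x + a := by positivity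
  have h2 : 0 < x + a + 1 := by positivity
  have hl1 : Real.log (x / (x + a)) ≤ -(a / (x + a)) := by
    have := Real.log_le_sub_one_of_pos (div_pos hx h1)
    have e : x / (x + a) - 1 = -(a / (x + a)) := by field_simp; ring
    linarith
  have hl2 : Real.log (x + a + 1) - Real.log (x + a) ≤ 1 / (x + a) := by
    rw [← Real.log_div h2.ne' h1.ne']
    have := Real.log_le_sub_one_of_pos (div_pos h2 h1)
    have e : (x + a + 1) / (x + a) - 1 = 1 / (x + a) := by field_simp; ring
    linarith
  rw [Real.rpow_def_of_pos h1, Real.rpow_def_of_pos h2, ← Real.exp_log (div_pos hx h1),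
    ← Real.exp_add, Real.exp_le_exp]
  have := mul_le_mul_of_nonneg_left hl2 ha.le
  have e : a * (1 / (x + a)) = a / (x + a) := by ring
  rw [e] at this
  linarith

/-- `x / (x + a) ≥ e^{-a / x} ≥ ((x - 1) / x)^a`. -/
theorem rpow_le_div_add {a x : ℝ} (ha : 0 < a) (hx : 1 < x) :
    (x - 1) ^ a ≤ x / (x + a) * x ^ a := by
  have h0 : 0 < x := by linarith
  have h1 : 0 < x + a := by positivity
  have h2 : 0 < x - 1 := by linarith
  have hl1 : -(a / x) ≤ Real.log (x / (x + a)) := by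
    rw [← inv_div (x + a) x, Real.log_inv]
    have := Real.log_le_sub_one_of_pos (div_pos h1 h0)
    have e : (x + a) / x - 1 = a / x := by field_simp; ring
    linarith
  have hl2 : Real.log (x - 1) - Real.log x ≤ -(1 / x) := by
    rw [← Real.log_div h2.ne' h0.ne']
    have := Real.log_le_sub_one_of_pos (div_pos h2 h0)
    have e : (x - 1) / x - 1 = -(1 / x) := by field_simp; ring
    linarith
  rw [Real.rpow_def_of_pos h0, Real.rpow_def_of_pos h2, ← Real.exp_log (div_pos h0 h1),
    ← Real.exp_add, Real.exp_le_exp]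
  have := mul_le_mul_of_nonneg_left hl2 ha.le
  have e : a * -(1 / x) = -(a / x) := by ring
  rw [e] at this
  linarith

theorem exists_abs_gegenbauer_eval_zero_le {a : ℝ} (ha : 0 < a) :
    ∃ B : ℝ, 0 < B ∧ ∀ t : ℕ, |(gegenbauer a (2 * t)).eval 0| * (t : ℝ) ^ a ≤ B := by
  refine ⟨(1 / 2 + a) ^ a, by positivity, fun t => ?_⟩
  have key : |(gegenbauer a (2 * t)).eval 0| * ((t : ℝ) + 1 / 2 + a) ^ a ≤ (1 / 2 + a) ^ a := by
    induction t with
    | zero => simp [gegenbauer]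
    | succ t ih =>
      refine le_trans ?_ ih
      rw [abs_gegenbauer_eval_zero_succ ha]
      have h := div_add_le_rpow (x := (t : ℝ) + 1 / 2) ha (by positivity)
      have := mul_le_mul_of_nonneg_left h (abs_nonneg ((gegenbauer a (2 * t)).eval 0))
      push_cast
      rw [show (t : ℝ) + 1 + 1 / 2 + a = (t : ℝ) + 1 / 2 + a + 1 by ring]
      linarith
  refine le_trans ?_ key
  gcongr
  linarith

theorem exists_le_abs_gegenbauer_eval_zero {a : ℝ} (ha : 0 < a) :
    ∃ A : ℝ, 0 < A ∧ ∀ t : ℕ, 1 ≤ t → A ≤ |(gegenbauer a (2 * t)).eval 0| * (t : ℝ) ^ a := by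
  have h0 : 0 < |(gegenbauer a 2).eval 0| := by
    have := abs_gegenbauer_eval_zero_succ ha 0
    norm_num [gegenbauer] at this ⊢
    positivity
  refine ⟨|(gegenbauer a 2).eval 0| * (1 / 2) ^ a, by positivity, fun t ht => ?_⟩
  have key : |(gegenbauer a 2).eval 0| * (1 / 2) ^ a ≤
      |(gegenbauer a (2 * t)).eval 0| * ((t : ℝ) - 1 / 2) ^ a := by
    induction t, ht using Nat.le_induction with
    | base => norm_num
    | succ t ht ih =>
      refine le_trans ih ?_
      have ht' : (1 : ℝ) ≤ t := by exact_mod_cast ht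
      rw [abs_gegenbauer_eval_zero_succ ha]
      have h := rpow_le_div_add (x := (t : ℝ) + 1 / 2) ha (by linarith)
      have := mul_le_mul_of_nonneg_left h (abs_nonneg ((gegenbauer a (2 * t)).eval 0))
      push_cast
      rw [show (t : ℝ) + 1 - 1 / 2 = (t : ℝ) + 1 / 2 by ring]
      rw [show (t : ℝ) + 1 / 2 - 1 = (t : ℝ) - 1 / 2 by ring] at this
      linarith
  refine le_trans key ?_
  have ht' : (1 : ℝ) ≤ t := by exact_mod_cast ht
  have : (0 : ℝ) ≤ t - 1 / 2 := by linarith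
  gcongr
  linarith

/-! ### Two-sided bounds for the even Gegenbauer polynomials -/

/-- Where the potential is at least a fixed fraction of its leading part, the bound comes from the
monotone energy; elsewhere `1 - x² = O(t⁻²)` and `|R| ≤ 1` suffices. -/
theorem exists_rpow_mul_gegenbauer_sq_le {a : ℝ} (ha : 0 < a) :
    ∃ M : ℝ, 0 < M ∧ ∀ t : ℕ, 1 ≤ t → ∀ x : ℝ, 0 ≤ x → x < 1 →
      (1 - x ^ 2) ^ a * (gegenbauer a (2 * t)).eval x ^ 2 ≤ M * ((t : ℝ) ^ (-a)) ^ 2 := by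
  obtain ⟨B, hB, hρ⟩ := exists_abs_gegenbauer_eval_zero_le ha
  refine ⟨2 * B ^ 2 + (2 * |a * (1 - a)|) ^ a, by positivity, fun t ht x hx0 hx1 => ?_⟩
  have ht' : (1 : ℝ) ≤ t := by exact_mod_cast ht
  have ht0 : (0 : ℝ) < t := by linarith
  have hs : 0 < 1 - x ^ 2 := by nlinarith
  have hs1 : 1 - x ^ 2 ≤ 1 := by nlinarith
  have hsa : 0 < (1 - x ^ 2) ^ a := Real.rpow_pos_of_pos hs a
  have hV0 := gegenbauerFlux_zero_of_even ha t
  have hT : 0 < (t : ℝ) ^ (-a) := Real.rpow_pos_of_pos ht0 _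
  have hρ' : (gegenbauer a (2 * t)).eval 0 ^ 2 ≤ B ^ 2 * ((t : ℝ) ^ (-a)) ^ 2 := by
    rw [← sq_abs, ← mul_pow, Real.rpow_neg ht0.le, ← div_eq_mul_inv]
    exact pow_le_pow_left₀ (abs_nonneg _) ((le_div_iff₀ (Real.rpow_pos_of_pos ht0 a)).2 (hρ t)) 2
  have hm : (0 : ℝ) ≤ (2 * |a * (1 - a)|) ^ a := by positivity
  have hmain : (1 - x ^ 2) ^ a * (gegenbauer a (2 * t)).eval x ^ 2
        ≤ 2 * (gegenbauer a (2 * t)).eval 0 ^ 2 ∨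
      (1 - x ^ 2) ^ a * (gegenbauer a (2 * t)).eval x ^ 2
        ≤ (2 * |a * (1 - a)|) ^ a * ((t : ℝ) ^ (-a)) ^ 2 := by
    rcases le_total a 1 with h1 | h1
    · left
      have h1' : 0 ≤ 1 - a := by linarith
      have hQ : 0 < gegenbauerPotential a (2 * t) x := by
        simp only [gegenbauerPotential]
        positivity
      have h := gegenbauerSonin_le_zero ha h1 hx0 hx1 hQ
      simp only [gegenbauerSonin, hV0] at h
      norm_num at h
      have h2 : 0 ≤ gegenbauerFlux a (2 * t) x ^ 2 / gegenbauerPotential a (2 * t) x := by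
        positivity
      have h3 := mul_nonneg hsa.le h2
      have h4 := sq_nonneg ((gegenbauer a (2 * t)).eval 0)
      linarith
    · have hμ : |a * (1 - a)| = a * (a - 1) := by
        rw [abs_of_nonpos (by nlinarith)]
        ring
      rw [hμ]
      have hμ0 : 0 ≤ a * (a - 1) := mul_nonneg ha.le (by linarith)
      set N : ℝ := ((2 * t : ℕ) : ℝ) + a
      have hN : (t : ℝ) ≤ N := by simp only [N]; push_cast; linarith
      rcases le_total (2 * (a * (a - 1))) (N ^ 2 * (1 - x ^ 2)) with h2 | h2
      · left
        have h := gegenbauerEnergy_le_zero (n := 2 * t) h1 hx0 hx1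
        simp only [gegenbauerEnergy, hV0] at h
        norm_num at h
        have hQ : N ^ 2 * (1 - x ^ 2) / 2 ≤ gegenbauerPotential a (2 * t) x := by
          simp only [gegenbauerPotential]
          linarith
        have hQ0 : gegenbauerPotential a (2 * t) 0 ≤ N ^ 2 := by
          simp only [gegenbauerPotential]
          linarith
        have e1 : (1 - x ^ 2) ^ a = (1 - x ^ 2) ^ (a - 1) * (1 - x ^ 2) := by
          rw [← Real.rpow_add_one hs.ne']
          ring_nf
        have hp : 0 < (1 - x ^ 2) ^ (a - 1) := Real.rpow_pos_of_pos hs _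
        have k1 := mul_le_mul_of_nonneg_right hQ0 (sq_nonneg ((gegenbauer a (2 * t)).eval 0))
        have k2 := mul_le_mul_of_nonneg_left (mul_le_mul_of_nonneg_right hQ
          (sq_nonneg ((gegenbauer a (2 * t)).eval x))) hp.le
        have k3 := mul_nonneg hp.le (sq_nonneg (gegenbauerFlux a (2 * t) x))
        have hN2 : 0 < N ^ 2 := by
          have : 0 < N := by linarith
          positivity
        refine le_of_mul_le_mul_left ?_ hN2
        rw [e1]
        linarith
      · right
        have hst : 1 - x ^ 2 ≤ 2 * (a * (a - 1)) * ((t : ℝ) ^ 2)⁻¹ := by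
          rw [← div_eq_mul_inv, le_div_iff₀ (by positivity)]
          have := mul_le_mul_of_nonneg_right (pow_le_pow_left₀ ht0.le hN 2) hs.le
          linarith
        have hR : (gegenbauer a (2 * t)).eval x ^ 2 ≤ 1 := by
          have := abs_gegenbauer_eval_cos_le ha (2 * t) (Real.arccos x)
          rw [Real.cos_arccos (by linarith) hx1.le] at this
          rw [← sq_abs]
          exact pow_le_one₀ (abs_nonneg _) this
        have e : ((t : ℝ) ^ (-a)) ^ 2 = (((t : ℝ) ^ 2)⁻¹) ^ a := by
          rw [Real.inv_rpow (by positivity), ← Real.rpow_natCast_mul ht0.le,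
            ← Real.rpow_mul_natCast ht0.le, ← Real.rpow_neg ht0.le]
          ring_nf
        rw [e, ← Real.mul_rpow (by positivity) (by positivity)]
        calc (1 - x ^ 2) ^ a * (gegenbauer a (2 * t)).eval x ^ 2 ≤ (1 - x ^ 2) ^ a * 1 := by
              gcongr
          _ ≤ _ := by
              rw [mul_one]
              gcongr
  rcases hmain with h | h
  · have := mul_nonneg hm (sq_nonneg ((t : ℝ) ^ (-a)))
    linarith
  · have := mul_nonneg (sq_nonneg B) (sq_nonneg ((t : ℝ) ^ (-a)))
    linarith

/-- The polynomial and its derivative cannot both be small at a point: one of the two energies is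
at least its value at `0`. -/
theorem mul_gegenbauer_eval_zero_sq_le {a : ℝ} (ha : 0 < a) {t : ℕ} {x : ℝ}
    (hx0 : 0 ≤ x) (hx1 : x < 1) (hQ : 1 ≤ gegenbauerPotential a (2 * t) x) :
    (1 - x ^ 2) * (gegenbauer a (2 * t)).eval 0 ^ 2 ≤
      gegenbauerFlux a (2 * t) x ^ 2 + (gegenbauer a (2 * t)).eval x ^ 2 := by
  have hs : 0 < 1 - x ^ 2 := by nlinarith
  have hs1 : 1 - x ^ 2 ≤ 1 := by nlinarith
  have hV0 := gegenbauerFlux_zero_of_even ha t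
  have hQ0 := gegenbauerPotential_le (a := a) (n := 2 * t) (x := 0) (y := x) ⟨le_rfl, hx0⟩
  set V := gegenbauerFlux a (2 * t) x
  set R := (gegenbauer a (2 * t)).eval x
  set ρ := (gegenbauer a (2 * t)).eval 0
  set Q := gegenbauerPotential a (2 * t) x
  rcases le_total a 1 with h1 | h1
  · have h := gegenbauerEnergy_zero_le (n := 2 * t) ha h1 hx0 hx1
    simp only [gegenbauerEnergy, hV0] at h
    norm_num at h
    set Q0 := gegenbauerPotential a (2 * t) 0
    have e1 : (1 - x ^ 2) ^ a = (1 - x ^ 2) ^ (a - 1) * (1 - x ^ 2) := by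
      rw [← Real.rpow_add_one hs.ne']
      ring_nf
    have hle : (1 - x ^ 2) ^ a ≤ 1 := Real.rpow_le_one hs.le hs1 ha.le
    have hQ01 : 1 ≤ Q0 := hQ.trans hQ0
    have k1 : V ^ 2 + Q * R ^ 2 ≤ Q0 * (V ^ 2 + R ^ 2) := by
      have := mul_le_mul_of_nonneg_right hQ01 (sq_nonneg V)
      have := mul_le_mul_of_nonneg_right hQ0 (sq_nonneg R)
      linarith
    have k2 : (1 - x ^ 2) * (Q0 * ρ ^ 2) ≤ (1 - x ^ 2) ^ a * (V ^ 2 + Q * R ^ 2) := by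
      rw [e1]
      have := mul_le_mul_of_nonneg_left h hs.le
      linarith
    have hnn : 0 ≤ V ^ 2 + Q * R ^ 2 := by positivity
    have k3 := mul_le_mul_of_nonneg_right hle hnn
    refine le_of_mul_le_mul_left ?_ (by linarith : (0 : ℝ) < Q0)
    linarith
  · have h := gegenbauerSonin_zero_le (n := 2 * t) h1 hx0 hx1 (by linarith)
    simp only [gegenbauerSonin, hV0] at h
    norm_num at h
    have hle : (1 - x ^ 2) ^ a ≤ 1 := Real.rpow_le_one hs.le hs1 ha.le
    have k1 : V ^ 2 / Q ≤ V ^ 2 := div_le_self (sq_nonneg V) hQ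
    have hnn : 0 ≤ V ^ 2 / Q + R ^ 2 := by positivity
    have k3 := mul_le_mul_of_nonneg_right hle hnn
    have k4 := mul_le_mul_of_nonneg_right hs1 (sq_nonneg ρ)
    linarith

/-- On an interval `[x₁, x₂]` of points `cos θ`, the even Gegenbauer polynomials decay no faster
than `t⁻ᵃ`: if they were uniformly smaller, then so would be their derivative at the point given
by the mean value theorem. -/
theorem not_gegenbauer_eval_le_rpow {a b : ℝ} (ha : 0 < a) (hab : a < b) {x₁ x₂ : ℝ}
    (h1 : 0 ≤ x₁) (h12 : x₁ < x₂) (h2 : x₂ < 1) (G : ℝ) :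
    ¬ ∀ t : ℕ, 1 ≤ t → ∀ x ∈ Set.Icc x₁ x₂,
      |(gegenbauer a (2 * t)).eval x| ≤ G * (t : ℝ) ^ (-b) := by
  intro hG
  obtain ⟨A, hA, hρ⟩ := exists_le_abs_gegenbauer_eval_zero ha
  have hs2 : 0 < 1 - x₂ ^ 2 := by nlinarith
  have hG0 : 0 ≤ G := by
    have := (abs_nonneg _).trans (hG 1 le_rfl x₁ ⟨le_rfl, h12.le⟩)
    simpa using this
  set H := 2 * G / (x₂ - x₁) + a * G
  have hd : 0 < x₂ - x₁ := by linarith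
  have hH : 0 ≤ H := by positivity
  -- the decay forced by the upper bound against the decay allowed by the energy
  have hkey : ∀ t : ℕ, 1 ≤ t → 1 ≤ (t : ℝ) ^ 2 * (1 - x₂ ^ 2) + a * (1 - a) →
      (1 - x₂ ^ 2) * A ^ 2 * ((t : ℝ) ^ (b - a)) ^ 2 ≤ H ^ 2 + G ^ 2 := by
    intro t ht hQ
    have ht' : (1 : ℝ) ≤ t := by exact_mod_cast ht
    have ht0 : (0 : ℝ) < t := by linarith
    set T := (t : ℝ) ^ (-b)
    have hT : 0 < T := Real.rpow_pos_of_pos ht0 _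
    obtain ⟨ξ, hξ, hξd⟩ := exists_hasDerivAt_eq_slope (fun x => (gegenbauer a (2 * t)).eval x)
      (fun x => (derivative (gegenbauer a (2 * t))).eval x) h12
      (gegenbauer a (2 * t)).continuous.continuousOn
      (fun x _ => (gegenbauer a (2 * t)).hasDerivAt x)
    have hξ0 : 0 ≤ ξ := h1.trans hξ.1.le
    have hξ1 : ξ < 1 := hξ.2.trans h2
    have hξs : 1 - x₂ ^ 2 ≤ 1 - ξ ^ 2 := by nlinarith [hξ.2]
    have hξs1 : 1 - ξ ^ 2 ≤ 1 := by nlinarith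
    have hR := hG t ht ξ ⟨hξ.1.le, hξ.2.le⟩
    have hR' : |(derivative (gegenbauer a (2 * t))).eval ξ| ≤ 2 * G / (x₂ - x₁) * T := by
      rw [hξd, abs_div, abs_of_pos hd, div_mul_eq_mul_div]
      gcongr
      have k1 := hG t ht x₁ ⟨le_rfl, h12.le⟩
      have k2 := hG t ht x₂ ⟨h12.le, le_rfl⟩
      refine (abs_sub _ _).trans ?_
      linarith
    have hV : |gegenbauerFlux a (2 * t) ξ| ≤ H * T := by
      rw [gegenbauerFlux]
      refine (abs_sub _ _).trans ?_
      rw [abs_mul, abs_mul, abs_mul, abs_of_pos (by linarith : 0 < 1 - ξ ^ 2), abs_of_pos ha,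
        abs_of_nonneg hξ0]
      have k1 := mul_le_mul hξs1 hR' (abs_nonneg _) zero_le_one
      have k2 : a * ξ * |(gegenbauer a (2 * t)).eval ξ| ≤ a * 1 * (G * T) := by
        gcongr
      simp only [H]
      linarith
    have hQ' : 1 ≤ gegenbauerPotential a (2 * t) ξ := by
      refine hQ.trans ?_
      simp only [gegenbauerPotential]
      gcongr
      push_cast
      linarith
    have hlow := mul_gegenbauer_eval_zero_sq_le ha hξ0 hξ1 hQ'
    have hup : gegenbauerFlux a (2 * t) ξ ^ 2 + (gegenbauer a (2 * t)).eval ξ ^ 2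
        ≤ (H ^ 2 + G ^ 2) * T ^ 2 := by
      have k1 := pow_le_pow_left₀ (abs_nonneg _) hV 2
      have k2 := pow_le_pow_left₀ (abs_nonneg _) hR 2
      rw [sq_abs] at k1 k2
      linarith
    have hA' : A * (t : ℝ) ^ (b - a) * T ≤ |(gegenbauer a (2 * t)).eval 0| := by
      have e : (t : ℝ) ^ (b - a) * T = ((t : ℝ) ^ a)⁻¹ := by
        rw [← Real.rpow_add ht0, ← Real.rpow_neg ht0.le]
        ring_nf
      rw [mul_assoc, e, ← div_eq_mul_inv, div_le_iff₀ (Real.rpow_pos_of_pos ht0 a)]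
      exact hρ t ht
    have hA2 := pow_le_pow_left₀ (by positivity) hA' 2
    rw [sq_abs] at hA2
    refine le_of_mul_le_mul_right ?_ (by positivity : 0 < T ^ 2)
    have k1 := mul_le_mul_of_nonneg_left hA2 hs2.le
    have k2 := mul_le_mul_of_nonneg_right hξs (sq_nonneg ((gegenbauer a (2 * t)).eval 0))
    linarith
  have hlim1 : Filter.Tendsto (fun t : ℕ => (1 - x₂ ^ 2) * A ^ 2 * ((t : ℝ) ^ (b - a)) ^ 2)
      Filter.atTop Filter.atTop := by
    refine Filter.Tendsto.const_mul_atTop (by positivity) ?_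
    exact (Filter.tendsto_pow_atTop two_ne_zero).comp
      ((tendsto_rpow_atTop (by linarith)).comp tendsto_natCast_atTop_atTop)
  have hlim2 : Filter.Tendsto (fun t : ℕ => (t : ℝ) ^ 2 * (1 - x₂ ^ 2) + a * (1 - a))
      Filter.atTop Filter.atTop := by
    refine Filter.tendsto_atTop_add_const_right _ _ (Filter.Tendsto.atTop_mul_const hs2 ?_)
    exact (Filter.tendsto_pow_atTop two_ne_zero).comp tendsto_natCast_atTop_atTop
  obtain ⟨t, ⟨ht1, ht2⟩, ht3⟩ := ((hlim1.eventually_gt_atTop (H ^ 2 + G ^ 2)).and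
    (hlim2.eventually_ge_atTop 1)).and (Filter.eventually_ge_atTop 1) |>.exists
  exact absurd (hkey t ht3 ht2) (not_le.2 ht1)

/-! ### Filter bounds and qualification of the ν-method -/

theorem heavyBall_eq_aeval {𝓧 : Type*} [NormedAddCommGroup 𝓧] [InnerProductSpace ℝ 𝓧]
    (α β : ℕ → ℝ) {n : ℕ} (x : Fin n → 𝓧) (y : Fin n → ℝ) (t : ℕ) :
    heavyBall α β x y t =
      aeval (empiricalCov x) (heavyBallPoly α β t) (samplingAdj x y) := by
  induction t using Nat.twoStepInduction with
  | zero => simp [heavyBall, heavyBallPoly]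
  | one =>
    simp [heavyBall, heavyBallPoly, Algebra.algebraMap_eq_smul_one]
  | more t ih0 ih1 =>
    simp only [heavyBall, heavyBallPoly, ih0, ih1]
    simp [Algebra.algebraMap_eq_smul_one, empiricalCov]

/-- The substitution `σ = K² (1 - x²)` maps `[0, 1)` onto `(0, K²]`. -/
theorem exists_eq_sq_mul_one_sub_sq {K σ : ℝ} (hK : 0 < K) (hσ : σ ∈ Set.Ioc 0 (K ^ 2)) :
    ∃ x : ℝ, 0 ≤ x ∧ x < 1 ∧ σ = K ^ 2 * (1 - x ^ 2) := by
  have hK2 : 0 < K ^ 2 := by positivity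
  have h1 : σ / K ^ 2 ≤ 1 := (div_le_one hK2).2 hσ.2
  have h0 : 0 < σ / K ^ 2 := div_pos hσ.1 hK2
  refine ⟨√(1 - σ / K ^ 2), Real.sqrt_nonneg _, ?_, ?_⟩
  · rw [Real.sqrt_lt' one_pos]
    linarith
  · rw [Real.sq_sqrt (by linarith)]
    field_simp
    ring

theorem isSpectralFilter_nuPoly {ν K κ : ℝ} (hν : 0 < ν) (hκ : 0 < κ) (hκK : κ ≤ K) :
    IsSpectralFilter κ (fun t : ℕ+ => 1 / ((t : ℕ) : ℝ) ^ 2)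
      (fun t σ => (nuPoly ν K t).eval σ) (2 / K ^ 2) 1 := by
  have hK : 0 < K := hκ.trans_le hκK
  have hmem : ∀ σ ∈ Set.Ioc (0 : ℝ) (κ ^ 2), σ ∈ Set.Ioc (0 : ℝ) (K ^ 2) := fun σ hσ =>
    ⟨hσ.1, hσ.2.trans (pow_le_pow_left₀ hκ.le hκK 2)⟩
  have hres : ∀ (t : ℕ+), ∀ σ ∈ Set.Ioc (0 : ℝ) (κ ^ 2),
      |residualFn (fun σ => (nuPoly ν K t).eval σ) σ| ≤ 1 ∧
      1 - residualFn (fun σ => (nuPoly ν K t).eval σ) σ ≤ 2 * ((t : ℕ) : ℝ) ^ 2 * (σ / K ^ 2) := by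
    intro t σ hσ
    obtain ⟨x, hx0, hx1, rfl⟩ := exists_eq_sq_mul_one_sub_sq hK (hmem σ hσ)
    rw [residualFn_nuPoly hν hK]
    have hc := Real.cos_arccos (by linarith : -1 ≤ x) hx1.le
    have h1 := abs_gegenbauer_eval_cos_le (a := 2 * ν) (by positivity) (2 * t) (Real.arccos x)
    have h2 := one_sub_gegenbauer_eval_cos_le (a := 2 * ν) (by positivity) t (Real.arccos x)
    rw [Real.sin_sq, hc] at h2
    rw [hc] at h1
    refine ⟨h1, ?_⟩
    rwa [mul_div_cancel_left₀ _ (by positivity)]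
  refine ⟨fun t => ?_, fun t σ hσ => ?_, fun t σ hσ => (hres t σ hσ).1⟩
  · have ht : (1 : ℝ) ≤ ((t : ℕ) : ℝ) := by exact_mod_cast t.2
    exact ⟨by positivity, div_le_one_of_le₀ (one_le_pow₀ ht) (by positivity)⟩
  · obtain ⟨h1, h2⟩ := hres t σ hσ
    have hσ0 := hσ.1
    -- `σ g(σ) = 1 - r(σ) ≥ 0`
    have h3 := (abs_le.1 h1).2
    simp only [residualFn] at h2 h3
    have hg : 0 ≤ (nuPoly ν K t).eval σ := by
      refine le_of_mul_le_mul_left ?_ hσ0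
      linarith
    rw [abs_of_nonneg hg]
    refine le_of_mul_le_mul_left ?_ hσ0
    have e : σ * (2 / K ^ 2 / (1 / ((t : ℕ) : ℝ) ^ 2)) = 2 * ((t : ℕ) : ℝ) ^ 2 * (σ / K ^ 2) := by
      field_simp
    rw [e]
    linarith

theorem one_div_sq_rpow (t : ℕ+) (q : ℝ) :
    (1 / ((t : ℕ) : ℝ) ^ 2) ^ q = ((t : ℕ) : ℝ) ^ (-(2 * q)) := by
  have ht : (0 : ℝ) < ((t : ℕ) : ℝ) := by exact_mod_cast t.2
  rw [one_div, Real.inv_rpow (by positivity), ← Real.rpow_natCast_mul ht.le,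
    ← Real.rpow_neg ht.le]
  norm_num

theorem exists_qualificationBound_nuPoly {ν : ℝ} (hν : 0 < ν) :
    ∃ c : ℝ, 0 < c ∧ ∀ K κ : ℝ, 0 < κ → κ ≤ K → K ≤ 1 →
      QualificationBound κ (fun t : ℕ+ => 1 / ((t : ℕ) : ℝ) ^ 2)
        (fun t σ => (nuPoly ν K t).eval σ) ν c := by
  obtain ⟨M, hM, hb⟩ := exists_rpow_mul_gegenbauer_sq_le (a := 2 * ν) (by positivity)
  refine ⟨√M, Real.sqrt_pos.2 hM, fun K κ hκ hκK hK1 t σ hσ => ?_⟩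
  have hK : 0 < K := hκ.trans_le hκK
  obtain ⟨x, hx0, hx1, rfl⟩ := exists_eq_sq_mul_one_sub_sq hK
    (⟨hσ.1, hσ.2.trans (pow_le_pow_left₀ hκ.le hκK 2)⟩ : σ ∈ Set.Ioc (0 : ℝ) (K ^ 2))
  have hs : 0 < 1 - x ^ 2 := by nlinarith
  have h := hb t t.2 x hx0 hx1
  rw [residualFn_nuPoly hν hK, one_div_sq_rpow]
  refine abs_le_of_sq_le_sq ?_ (by positivity)
  rw [mul_pow, mul_pow, Real.sq_sqrt hM.le]
  refine le_trans ?_ h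
  have e : ((K ^ 2 * (1 - x ^ 2)) ^ ν) ^ 2 ≤ (1 - x ^ 2) ^ (2 * ν) := by
    rw [← Real.rpow_mul_natCast (by positivity), Nat.cast_ofNat, mul_comm ν 2]
    refine Real.rpow_le_rpow (by positivity) ?_ (by positivity)
    exact mul_le_of_le_one_left hs.le (pow_le_one₀ hK.le hK1)
  have := mul_le_mul_of_nonneg_left e (sq_nonneg ((gegenbauer (2 * ν) (2 * t)).eval x))
  linarith

/-- No exponent above `ν` qualifies: on a compact part of `(0, κ²]` the residuals would decay
faster than `t^{-2ν}`. -/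
theorem le_of_qualificationBound_nuPoly {ν K κ q F : ℝ} (hν : 0 < ν) (hκ : 0 < κ) (hκK : κ ≤ K)
    (hF : QualificationBound κ (fun t : ℕ+ => 1 / ((t : ℕ) : ℝ) ^ 2)
      (fun t σ => (nuPoly ν K t).eval σ) q F) : q ≤ ν := by
  by_contra! hq
  have hK : 0 < K := hκ.trans_le hκK
  -- `x₁` corresponds to the right end `κ²` of the interval
  obtain ⟨x₁, hx0, hx1, hx⟩ := exists_eq_sq_mul_one_sub_sq hK
    (⟨by positivity, pow_le_pow_left₀ hκ.le hκK 2⟩ : κ ^ 2 ∈ Set.Ioc (0 : ℝ) (K ^ 2))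
  set x₂ := (1 + x₁) / 2
  have h12 : x₁ < x₂ := by simp only [x₂]; linarith
  have h2 : x₂ < 1 := by simp only [x₂]; linarith
  have hs2 : 0 < 1 - x₂ ^ 2 := by nlinarith
  set m := K ^ 2 * (1 - x₂ ^ 2)
  have hm : 0 < m := by positivity
  refine not_gegenbauer_eval_le_rpow (a := 2 * ν) (b := 2 * q) (by positivity) (by linarith)
    hx0 h12 h2 (F / m ^ q) fun t ht x hx' => ?_
  have hxs : 1 - x₂ ^ 2 ≤ 1 - x ^ 2 := by nlinarith [hx'.1, hx'.2]
  have hmσ : m ≤ K ^ 2 * (1 - x ^ 2) := mul_le_mul_of_nonneg_left hxs (by positivity)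
  have hσ : K ^ 2 * (1 - x ^ 2) ∈ Set.Ioc (0 : ℝ) (κ ^ 2) := by
    refine ⟨hm.trans_le hmσ, ?_⟩
    rw [hx]
    have : x₁ ^ 2 ≤ x ^ 2 := pow_le_pow_left₀ hx0 hx'.1 2
    gcongr
  obtain ⟨t, rfl⟩ : ∃ p : ℕ+, (p : ℕ) = t := ⟨⟨t, ht⟩, rfl⟩
  have h := hF t _ hσ
  beta_reduce at h
  rw [one_div_sq_rpow] at h
  rw [residualFn_nuPoly hν hK, abs_mul, abs_of_pos (Real.rpow_pos_of_pos hσ.1 q)] at h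
  rw [div_mul_eq_mul_div, le_div_iff₀ (by positivity)]
  refine le_trans ?_ h
  have := Real.rpow_le_rpow hm.le hmσ (by linarith : 0 ≤ q)
  gcongr

theorem mainTheorem4 (ν : ℝ) (hν : 0 < ν) :
    -- the polynomials are those of the iterates of the ν-method
    (∀ (𝓧 : Type*) [NormedAddCommGroup 𝓧] [InnerProductSpace ℝ 𝓧] (K : ℝ) (_ : 0 < K)
      (n : ℕ) (x : Fin n → 𝓧) (y : Fin n → ℝ) (t : ℕ),
      heavyBall (nuAlpha ν K) (nuBeta ν) x y t =
        aeval (empiricalCov x) (nuPoly ν K t) (samplingAdj x y)) ∧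
    ∃ c : ℝ, 0 < c ∧ ∀ κ : ℝ, 0 < κ → κ ≤ 1 →
      -- step-sizes without the factor `1/κ²`
      (IsSpectralFilter κ (fun t : ℕ+ => 1 / ((t : ℕ) : ℝ) ^ 2)
          (fun t σ => (nuPoly ν 1 t).eval σ) 2 1 ∧
        QualificationBound κ (fun t : ℕ+ => 1 / ((t : ℕ) : ℝ) ^ 2)
          (fun t σ => (nuPoly ν 1 t).eval σ) ν c ∧
        HasQualification κ (fun t : ℕ+ => 1 / ((t : ℕ) : ℝ) ^ 2)
          (fun t σ => (nuPoly ν 1 t).eval σ) ν) ∧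
      -- step-sizes with the factor `1/κ²`
      (IsSpectralFilter κ (fun t : ℕ+ => 1 / ((t : ℕ) : ℝ) ^ 2)
          (fun t σ => (nuPoly ν κ t).eval σ) (2 / κ ^ 2) 1 ∧
        QualificationBound κ (fun t : ℕ+ => 1 / ((t : ℕ) : ℝ) ^ 2)
          (fun t σ => (nuPoly ν κ t).eval σ) ν c ∧
        HasQualification κ (fun t : ℕ+ => 1 / ((t : ℕ) : ℝ) ^ 2)
          (fun t σ => (nuPoly ν κ t).eval σ) ν) := by
  refine ⟨fun 𝓧 _ _ K _ n x y t => heavyBall_eq_aeval _ _ x y t, ?_⟩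
  obtain ⟨c, hc, hb⟩ := exists_qualificationBound_nuPoly hν
  refine ⟨c, hc, fun κ hκ hκ1 => ⟨⟨?_, hb 1 κ hκ hκ1 le_rfl, ⟨hν.le, c, hb 1 κ hκ hκ1 le_rfl⟩, ?_⟩,
    isSpectralFilter_nuPoly hν hκ le_rfl, hb κ κ hκ le_rfl hκ1,
    ⟨hν.le, c, hb κ κ hκ le_rfl hκ1⟩, ?_⟩⟩
  · simpa using isSpectralFilter_nuPoly hν hκ hκ1
  · rintro q ⟨_, F, hF⟩
    exact le_of_qualificationBound_nuPoly hν hκ hκ1 hF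
  · rintro q ⟨_, F, hF⟩
    exact le_of_qualificationBound_nuPoly hν hκ le_rfl hF
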